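/- Consider Herman's algorithm on a ring of $N\ge 1$ processors $1,\dots,N$, where the successor of processor $x$ is $x+1$ modulo $N$. At each time step, every processor that holds a token independently keeps it or passes it to the next processor, each with probability $\tfrac12$; all updates are simultaneous, and if a processor that keeps its token also receives one, then the two tokens annihilate each other. A state is stable if exactly one token remains. Let $A^{(0)},A^{(1)},\dots$ be the random sequence of states, started from a fixed state $A^{(0)}$ with an odd number of tokens. The step from time $t$ to time $t+1$ costs $\frac{m-1}{2}$ if $A^{(t)}$ has $m$ tokens; let $c_t$ be the cost accumulated by time $t$ (so $c_0=0$), and let $T$ be the earliest time at which the state is stable. Let $b_1<\dots<b_m$ be the positions of the tokens of $A^{(0)}$, and let $\boldsymbol a^{(0)}=(a_1,\dots,a_m)$ be the vector of gaps between consecutive tokens: $a_i=b_{i+1}-b_i$ for $i<m$ and $a_m=N+b_1-b_m$. For odd $m$ put $$\operatorname{steg}(a_1,\dots,a_m)=\sum_{\substack{1\le i<j<k\le m\\ j-i,\ k-j\ \text{odd}}}a_ia_ja_k ,$$ so that $\operatorname{steg}(a_1)=0$. Theorem. Almost surely $T<\infty$ and $c_t=c_T$ for all $t\ge T$. The total cost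 $c_T$ is integrable, and $$\mathbb E(c_T)=\frac4N\,\operatorname{steg}\bigl(\boldsymbol a^{(0)}\bigr).$$ -/

import Mathlib

open MeasureTheory

namespace Herman

/-- `steg (a₁, …, aₘ)`: the sum of all triples with even gaps, i.e. of the products
`aᵢ aⱼ aₖ` with `i < j < k` such that the number of unused indices strictly between
cyclically consecutive used ones is even. For odd `m` this says that `j - i` and `k - j`
are both odd (the third gap is then even automatically). -/
def steg {m : ℕ} (a : Fin m → ℝ) : ℝ :=
  ∑ i : Fin m, ∑ j : Fin m, ∑ k : Fin m,
    if i < j ∧ j < k ∧ Odd ((j : ℕ) - (i : ℕ)) ∧ Odd ((k : ℕ) - (j : ℕ)) then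
      a i * a j * a k
    else 0

/-- A state of the ring of `N` processors: the set of processors that hold a token.
The successor of processor `x` in the ring is `x + 1` (addition modulo `N`). -/
abbrev State (N : ℕ) : Type := Finset (Fin N)

/-- The vector of distances between consecutive tokens: with `b₁ < ⋯ < bₘ` the positions of
the tokens, the components are `bᵢ₊₁ - bᵢ` for `i < m`, and `N + b₁ - bₘ` for `i = m`. -/
def gaps {N : ℕ} (A : State N) (i : Fin A.card) : ℝ :=
  if h : (i : ℕ) + 1 < A.card then
    ((A.orderEmbOfFin rfl ⟨(i : ℕ) + 1, h⟩ : ℕ) : ℝ) - ((A.orderEmbOfFin rfl i : ℕ) : ℝ)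
  else
    (N : ℝ) + ((A.orderEmbOfFin rfl ⟨0, i.pos⟩ : ℕ) : ℝ) - ((A.orderEmbOfFin rfl i : ℕ) : ℝ)

/-- The state following `A` when exactly the processors in `P ⊆ A` pass their token to the
next processor and those in `A \ P` keep it. A kept token and a token received by the same
processor annihilate each other, hence the symmetric difference. -/
def move {N : ℕ} [NeZero N] (A P : State N) : State N :=
  symmDiff (A \ P) (P.image fun x => x + 1)

/-- The law of the state following `A`: each processor with a token independently keeps or
passes it with probability `1 / 2`, that is, the set `P` of processors that pass their token
is uniformly distributed among the subsets of `A`. -/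
noncomputable def stepLaw {N : ℕ} [NeZero N] (A : State N) : PMF (State N) :=
  (PMF.uniformOfFinset A.powerset ⟨∅, Finset.empty_mem_powerset A⟩).map (move A)

/-- `A 0, A 1, …` is a run of Herman's algorithm started at `A₀`: a Markov chain on the
states with initial state `A₀` and one-step transition probabilities `stepLaw`. -/
structure IsRun {N : ℕ} [NeZero N] {Ω : Type*} [MeasurableSpace Ω] (μ : Measure Ω)
    (A : ℕ → Ω → State N) (A₀ : State N) : Prop where
  measurable : ∀ (t : ℕ) (B : State N), MeasurableSet {ω | A t ω = B}
  start : ∀ᵐ ω ∂μ, A 0 ω = A₀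
  markov : ∀ (t : ℕ) (x : ℕ → State N),
    μ {ω | ∀ s ≤ t + 1, A s ω = x s} = μ {ω | ∀ s ≤ t, A s ω = x s} * stepLaw (x t) (x (t + 1))

/-- A state is stable if it has exactly one token. -/
def IsStable {N : ℕ} (A : State N) : Prop := A.card = 1

/-- The cost of a step taken from a state with `m` tokens is `(m - 1) / 2`. -/
noncomputable def stepCost {N : ℕ} (A : State N) : ℝ := ((A.card : ℝ) - 1) / 2

/-- The cost `c_t` accumulated by time `t`. -/
noncomputable def cost {N : ℕ} {Ω : Type*} (A : ℕ → Ω → State N) (t : ℕ) (ω : Ω) : ℝ :=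
  ∑ s ∈ Finset.range t, stepCost (A s ω)

/-- The stabilisation time: the earliest time at which the state is stable
(with value `0` if there is no such time). -/
noncomputable def stabTime {N : ℕ} {Ω : Type*} (A : ℕ → Ω → State N) (ω : Ω) : ℕ :=
  sInf {t | IsStable (A t ω)}

/-- The total cost: the cost accumulated until stabilisation. -/
noncomputable def totalCost {N : ℕ} {Ω : Type*} (A : ℕ → Ω → State N) (ω : Ω) : ℝ :=
  cost A (stabTime A ω) ω

end Herman

namespace Herman

/-! Cut the ring open at the origin and give each unit edge the spin `(-1)^(number of tokens before
it)`. For an odd number of tokens the spin sequence is antiperiodic with period `N`. Then `steg` of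
the gaps counts the triples of edges with alternating spins. The indicator of such a triple is
quadratic in the spins, and summation turns `steg` into a constant minus a quarter of `∑_{u<v} (N -
2(v-u)) s_u s_v` (`steg_gaps_eq`).

In one step, up to a common sign, each spin becomes itself or its predecessor with equal
probability, independently for different edges; so the expected product of two spins is the product
of two averages (`sum_powerset_spin_move`). The coefficient `N - 2d` is linear in `d` and changes
sign under `d ↦ N - d`. Hence averaging an antiperiodic `±1` sequence changes the form only by a
constant and a nearest-neighbour sum (`sum_averaged_sub_of_antiperiodic`), and that sum counts
tokens. Thus `steg` drops in expectation by exactly `N / 4` times the cost of the step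
(`sum_powerset_steg_move`).

Telescoping gives expected cost up to time `n` as `4 / N` times the drop of the expectation of
`steg`. The expected step costs are therefore summable and tend to `0`; on the finite state space
they dominate `steg` up to a factor, so its expectation tends to `0` as well
(`hasSum_integral_stepCost`). Finite expected total cost forces stabilisation, because every
unstable step costs at least `1`. -/

/-! ### Quadratic forms in antiperiodic sequences -/

open Finset in
/-- Telescoped form of the change of the quadratic form `∑_{u<v} (c - 2(v-u)) t_{u+1} t_{v+1}`
when each entry is averaged with its predecessor. -/
theorem sum_averaged_sub_eq (c : ℝ) (t : ℕ → ℝ) (n : ℕ) :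
    ∑ v ∈ range n, ∑ u ∈ range v, (c - 2 * ((v : ℝ) - u)) *
      ((t u + t (u + 1)) * (t v + t (v + 1)) - 4 * (t (u + 1) * t (v + 1))) =
    -2 * t n * ∑ u ∈ range n, (c - 2 * ((n : ℝ) - u)) * t (u + 1)
      - 2 * t n * ∑ u ∈ range n, t (u + 1)
      + t 0 * ∑ v ∈ range n, (c - 2 * (v : ℝ)) * (t v + t (v + 1))
      + ∑ v ∈ range n, (-c * t v ^ 2 - c * (t v * t (v + 1)) + (2 * c - 2) * t (v + 1) ^ 2) := by
  have hP : ∀ n, ∑ u ∈ range n, t u = ∑ u ∈ range n, t (u + 1) + t 0 - t n := by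
    intro n
    have := sum_range_succ' t n
    rw [sum_range_succ] at this
    linarith
  -- Summation by parts: the coefficient is linear in `u`, so an index shift costs only a plain sum
  -- and boundary terms.
  have hR : ∀ n : ℕ, ∑ u ∈ range n, (c - 2 * ((n : ℝ) - u)) * t u =
      ∑ u ∈ range n, (c - 2 * ((n : ℝ) - u)) * t (u + 1) + 2 * ∑ u ∈ range n, t (u + 1)
        + (c - 2 * (n : ℝ)) * t 0 - c * t n := by
    intro n
    have := sum_range_succ' (fun u => (c - 2 * ((n : ℝ) - u)) * t u) n
    rw [sum_range_succ] at this
    rw [mul_sum, ← sum_add_distrib]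
    have h2 : ∑ u ∈ range n, (c - 2 * ((n : ℝ) - (u + 1 : ℕ))) * t (u + 1) =
        ∑ u ∈ range n, ((c - 2 * ((n : ℝ) - u)) * t (u + 1) + 2 * t (u + 1)) := by
      refine sum_congr rfl fun u _ => ?_
      push_cast; ring
    rw [h2] at this
    push_cast at this
    linarith
  have hS : ∀ n : ℕ, ∑ u ∈ range (n + 1), (c - 2 * (((n + 1 : ℕ) : ℝ) - u)) * t (u + 1) =
      ∑ u ∈ range n, (c - 2 * ((n : ℝ) - u)) * t (u + 1) - 2 * ∑ u ∈ range n, t (u + 1)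
        + (c - 2) * t (n + 1) := by
    intro n
    rw [sum_range_succ, mul_sum, ← sum_sub_distrib]
    congr 1
    · refine sum_congr rfl fun u _ => ?_
      push_cast; ring
    · push_cast; ring
  induction n with
  | zero => simp
  | succ n ih =>
    rw [sum_range_succ, ih, hS, sum_range_succ (fun u => t (u + 1)),
      sum_range_succ (fun v : ℕ => (c - 2 * (v : ℝ)) * (t v + t (v + 1))),
      sum_range_succ (fun v : ℕ => -c * t v ^ 2 - c * (t v * t (v + 1)) +
        (2 * c - 2) * t (v + 1) ^ 2)]
    have h : ∑ u ∈ range n, (c - 2 * ((n : ℝ) - u)) *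
        ((t u + t (u + 1)) * (t n + t (n + 1)) - 4 * (t (u + 1) * t (n + 1))) =
        (t n + t (n + 1)) * ∑ u ∈ range n, (c - 2 * ((n : ℝ) - u)) * t u +
        (t n - 3 * t (n + 1)) * ∑ u ∈ range n, (c - 2 * ((n : ℝ) - u)) * t (u + 1) := by
      rw [mul_sum, mul_sum, ← sum_add_distrib]
      refine sum_congr rfl fun u _ => ?_
      ring
    rw [h, hR]
    ring

open Finset in
/-- For an antiperiodic `±1` sequence, averaging each entry with its predecessor changes the
quadratic form by a multiple of the nearest-neighbour correlation. -/
theorem sum_averaged_sub_of_antiperiodic (t : ℕ → ℝ) (n : ℕ) (ht : ∀ k, t k ^ 2 = 1)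
    (hn : t n = -t 0) :
    ∑ v ∈ range n, ∑ u ∈ range v, ((n : ℝ) - 2 * ((v : ℝ) - u)) *
      ((t u + t (u + 1)) * (t v + t (v + 1)) - 4 * (t (u + 1) * t (v + 1))) =
    n * ((n : ℝ) - 2) - n * ∑ v ∈ range n, t v * t (v + 1) := by
  rw [sum_averaged_sub_eq, hn]
  have h1 : ∑ v ∈ range n, ((n : ℝ) - 2 * (v : ℝ)) * t v =
      ∑ v ∈ range n, ((n : ℝ) - 2 * (v : ℝ)) * t (v + 1) - 2 * ∑ v ∈ range n, t (v + 1) := by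
    have := sum_range_succ' (fun v : ℕ => ((n : ℝ) - 2 * (v : ℝ)) * t v) n
    rw [sum_range_succ, hn] at this
    rw [mul_sum, ← sum_sub_distrib]
    have h2 : ∑ v ∈ range n, ((n : ℝ) - 2 * ((v + 1 : ℕ) : ℝ)) * t (v + 1) =
        ∑ v ∈ range n, (((n : ℝ) - 2 * (v : ℝ)) * t (v + 1) - 2 * t (v + 1)) := by
      refine sum_congr rfl fun u _ => ?_
      push_cast; ring
    rw [h2] at this
    push_cast at this
    linarith
  -- The coefficient is odd under `d ↦ n - d`; together with `t n = -t 0` this makes all boundary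
  -- terms cancel.
  have h3 : ∑ u ∈ range n, ((n : ℝ) - 2 * ((n : ℝ) - u)) * t (u + 1) =
      -∑ u ∈ range n, ((n : ℝ) - 2 * (u : ℝ)) * t (u + 1) := by
    rw [← sum_neg_distrib]
    refine sum_congr rfl fun u _ => ?_
    ring
  have h4 : ∑ v ∈ range n, (-(n : ℝ) * t v ^ 2 - n * (t v * t (v + 1)) +
      (2 * n - 2) * t (v + 1) ^ 2) = n * ((n : ℝ) - 2) - n * ∑ v ∈ range n, t v * t (v + 1) := by
    simp_rw [ht]
    rw [sum_add_distrib, sum_sub_distrib, mul_sum]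
    simp only [sum_const, card_range, nsmul_eq_mul]
    ring
  rw [h4, h3]
  simp_rw [mul_add]
  rw [sum_add_distrib, h1]
  ring

open Finset in
/-- Summing the pair terms of all triples `u < v < w` with signs `+, +, -`. -/
theorem sum_triple_pair_terms (f : ℕ → ℕ → ℝ) (n : ℕ) :
    ∑ w ∈ range n, ∑ v ∈ range w, ∑ u ∈ range v, (f u v + f v w - f u w) =
    ∑ v ∈ range n, ∑ u ∈ range v, ((n : ℝ) - 2 * ((v : ℝ) - u)) * f u v := by
  -- An index `u` is the larger one in `u` pairs and the smaller one in `n - 1 - u` pairs.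
  have h : ∀ (g : ℕ → ℝ) (n : ℕ), ∑ v ∈ range n, ∑ u ∈ range v, (g v - g u) =
      ∑ u ∈ range n, (2 * (u : ℝ) + 1 - n) * g u := by
    intro g n
    induction n with
    | zero => simp
    | succ n ih =>
      rw [sum_range_succ, ih, sum_range_succ, sum_sub_distrib, sum_const, card_range,
        nsmul_eq_mul]
      have : ∑ u ∈ range n, (2 * (u : ℝ) + 1 - (n + 1 : ℕ)) * g u =
          ∑ u ∈ range n, (2 * (u : ℝ) + 1 - n) * g u - ∑ u ∈ range n, g u := by
        rw [← sum_sub_distrib]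
        refine sum_congr rfl fun u _ => ?_
        push_cast; ring
      rw [this]
      push_cast; ring
  induction n with
  | zero => simp
  | succ n ih =>
    rw [sum_range_succ, ih, sum_range_succ]
    have h1 : ∑ v ∈ range n, ∑ u ∈ range v, (((n + 1 : ℕ) : ℝ) - 2 * ((v : ℝ) - u)) * f u v =
        ∑ v ∈ range n, ∑ u ∈ range v, ((n : ℝ) - 2 * ((v : ℝ) - u)) * f u v +
        ∑ v ∈ range n, ∑ u ∈ range v, f u v := by
      simp_rw [← sum_add_distrib]
      refine sum_congr rfl fun v _ => sum_congr rfl fun u _ => ?_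
      push_cast; ring
    have h2 : ∑ v ∈ range n, ∑ u ∈ range v, (f u v + f v n - f u n) =
        ∑ v ∈ range n, ∑ u ∈ range v, f u v + ∑ u ∈ range n, (2 * (u : ℝ) + 1 - n) * f u n := by
      rw [← h (fun u => f u n)]
      simp_rw [← sum_add_distrib]
      refine sum_congr rfl fun v _ => sum_congr rfl fun u _ => ?_
      ring
    have h3 : ∑ u ∈ range n, (((n + 1 : ℕ) : ℝ) - 2 * ((n : ℝ) - u)) * f u n =
        ∑ u ∈ range n, (2 * (u : ℝ) + 1 - n) * f u n := by
      refine sum_congr rfl fun u _ => ?_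
      push_cast; ring
    rw [h1, h2, h3]
    ring

/-! ### Spins, token counts and gaps -/

/-- The number of tokens at positions smaller than `k`. -/
def tokensBelow {N : ℕ} (A : State N) (k : ℕ) : ℕ := (A.filter fun a : Fin N => (a : ℕ) < k).card

/-- The spin of the unit edge ending at `k`: the parity sign of the tokens below `k`. -/
noncomputable def spin {N : ℕ} (A : State N) (k : ℕ) : ℝ :=
  ∏ a ∈ A, if (a : ℕ) < k then -1 else 1

theorem spin_eq_pow {N : ℕ} (A : State N) (k : ℕ) : spin A k = (-1) ^ tokensBelow A k := by
  unfold spin tokensBelow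
  rw [Finset.prod_ite]
  simp

theorem tokensBelow_mono {N : ℕ} (A : State N) : Monotone (tokensBelow A) := by
  intro k l h
  refine Finset.card_le_card fun a ha => ?_
  simp only [Finset.mem_filter] at ha ⊢
  exact ⟨ha.1, ha.2.trans_le h⟩

theorem tokensBelow_le {N : ℕ} (A : State N) (k : ℕ) : tokensBelow A k ≤ A.card :=
  Finset.card_filter_le _ _

theorem lt_tokensBelow_iff {N : ℕ} (A : State N) (k : ℕ) (i : Fin A.card) :
    (i : ℕ) < tokensBelow A k ↔ (A.orderEmbOfFin rfl i : ℕ) < k := by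
  have hb : tokensBelow A k =
      (Finset.univ.filter fun j : Fin A.card => (A.orderEmbOfFin rfl j : ℕ) < k).card := by
    unfold tokensBelow
    rw [← Finset.card_map (A.orderEmbOfFin rfl).toEmbedding]
    refine congrArg Finset.card ?_
    ext a
    simp only [Finset.mem_filter, Finset.mem_map, Finset.mem_univ, true_and]
    constructor
    · rintro ⟨ha, hk⟩
      have : a ∈ Set.range (A.orderEmbOfFin rfl) := by
        rw [Finset.range_orderEmbOfFin]; exact ha
      obtain ⟨j, rfl⟩ := this
      exact ⟨j, hk, rfl⟩
    · rintro ⟨j, hj, rfl⟩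
      exact ⟨Finset.orderEmbOfFin_mem A rfl j, hj⟩
  rw [hb]
  constructor
  · intro h
    by_contra hk
    have : (Finset.univ.filter fun j : Fin A.card => (A.orderEmbOfFin rfl j : ℕ) < k) ⊆
        Finset.Iio i := by
      intro j hj
      simp only [Finset.mem_filter, Finset.mem_univ, true_and, Finset.mem_Iio] at hj ⊢
      by_contra hij
      have : A.orderEmbOfFin rfl i ≤ A.orderEmbOfFin rfl j :=
        (A.orderEmbOfFin rfl).monotone (not_lt.1 hij)
      have : (A.orderEmbOfFin rfl i : ℕ) ≤ A.orderEmbOfFin rfl j := this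
      omega
    have := Finset.card_le_card this
    rw [Fin.card_Iio] at this
    omega
  · intro h
    have : Finset.Iic i ⊆
        Finset.univ.filter fun j : Fin A.card => (A.orderEmbOfFin rfl j : ℕ) < k := by
      intro j hj
      simp only [Finset.mem_filter, Finset.mem_univ, true_and, Finset.mem_Iic] at hj ⊢
      have : A.orderEmbOfFin rfl j ≤ A.orderEmbOfFin rfl i :=
        (A.orderEmbOfFin rfl).monotone hj
      have : (A.orderEmbOfFin rfl j : ℕ) ≤ A.orderEmbOfFin rfl i := this
      omega
    have := Finset.card_le_card this
    rw [Fin.card_Iic] at this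
    omega

/-- The number of unit edges of the ring, cut open at the origin, that lie behind exactly `l`
tokens. -/
def edgesBehind {N : ℕ} (A : State N) (l : ℕ) : ℕ :=
  ((Finset.range N).filter fun x => tokensBelow A (x + 1) = l).card

theorem card_filter_le_tokensBelow {N : ℕ} (A : State N) (i : Fin A.card) :
    ((Finset.range N).filter fun x => (i : ℕ) + 1 ≤ tokensBelow A (x + 1)).card =
      N - (A.orderEmbOfFin rfl i : ℕ) := by
  have : ((Finset.range N).filter fun x => (i : ℕ) + 1 ≤ tokensBelow A (x + 1)) =
      Finset.Ico (A.orderEmbOfFin rfl i : ℕ) N := by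
    ext x
    simp only [Finset.mem_filter, Finset.mem_range, Finset.mem_Ico, Nat.succ_le_iff,
      lt_tokensBelow_iff]
    omega
  rw [this, Nat.card_Ico]

theorem edgesBehind_add_card {N : ℕ} (A : State N) (l : ℕ) :
    edgesBehind A l + ((Finset.range N).filter fun x => l + 1 ≤ tokensBelow A (x + 1)).card =
      ((Finset.range N).filter fun x => l ≤ tokensBelow A (x + 1)).card := by
  unfold edgesBehind
  rw [← Finset.card_union_of_disjoint]
  · congr 1
    ext x
    simp only [Finset.mem_union, Finset.mem_filter]
    constructor
    · rintro (h | h) <;> exact ⟨h.1, by omega⟩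
    · rintro ⟨h, h'⟩
      rcases h'.eq_or_lt with h' | h'
      · exact Or.inl ⟨h, h'.symm⟩
      · exact Or.inr ⟨h, h'⟩
  · rw [Finset.disjoint_left]
    intro x hx hy
    simp only [Finset.mem_filter] at hx hy
    omega

/-- Only the last gap crosses the origin; the cut divides it into the edges behind all tokens and
the edges behind none. -/
theorem gaps_eq {N : ℕ} (A : State N) (i : Fin A.card) :
    gaps A i = edgesBehind A (i + 1) + if (i : ℕ) + 1 = A.card then (edgesBehind A 0 : ℝ) else 0 := by
  have hlt : ∀ j : Fin A.card, (A.orderEmbOfFin rfl j : ℕ) < N := fun j => (A.orderEmbOfFin rfl j).2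
  have e1 := edgesBehind_add_card A (i + 1)
  rw [card_filter_le_tokensBelow] at e1
  have hi := hlt i
  unfold gaps
  split_ifs with h h' h'
  · omega
  · have e2 := card_filter_le_tokensBelow A ⟨i + 1, h⟩
    have hi' := hlt ⟨i + 1, h⟩
    simp only at e2
    rw [e2] at e1
    have hle : (A.orderEmbOfFin rfl i : ℕ) ≤ A.orderEmbOfFin rfl ⟨i + 1, h⟩ := by
      have : A.orderEmbOfFin rfl i ≤ A.orderEmbOfFin rfl ⟨i + 1, h⟩ :=
        (A.orderEmbOfFin rfl).monotone (by rw [Fin.le_def]; simp)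
      exact this
    have e3 : edgesBehind A (i + 1) + (A.orderEmbOfFin rfl i : ℕ) =
        A.orderEmbOfFin rfl ⟨i + 1, h⟩ := by omega
    rw [← e3]
    push_cast; ring
  · have e2 : ((Finset.range N).filter fun x => (i : ℕ) + 1 + 1 ≤ tokensBelow A (x + 1)).card = 0 := by
      rw [Finset.card_eq_zero, Finset.filter_eq_empty_iff]
      intro x _
      have := tokensBelow_le A (x + 1)
      omega
    rw [e2] at e1
    have e0 := edgesBehind_add_card A 0
    have e3 := card_filter_le_tokensBelow A ⟨0, i.pos⟩
    have h0 := hlt ⟨0, i.pos⟩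
    simp only at e3
    rw [e3] at e0
    simp only [zero_le, Finset.filter_true, Finset.card_range] at e0
    have e4 : edgesBehind A 0 = (A.orderEmbOfFin rfl ⟨0, i.pos⟩ : ℕ) := by omega
    have e5 : N = edgesBehind A (i + 1) + (A.orderEmbOfFin rfl i : ℕ) := by omega
    rw [e4]
    have e6 : (N : ℝ) = edgesBehind A (i + 1) + ((A.orderEmbOfFin rfl i : ℕ) : ℝ) := by
      exact_mod_cast e5
    rw [e6]; ring
  · omega

/-! ### `steg` as a count of edge triples and as a quadratic form -/

/-- The indicator of a strictly increasing triple of indices with odd differences. -/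
noncomputable def evenTriple (i j k : ℕ) : ℝ :=
  if i < j ∧ j < k ∧ Odd (j - i) ∧ Odd (k - j) then 1 else 0

open Finset in
/-- Splitting the last entry as `x m + x 0` does not change `steg`, if `m` is odd. -/
theorem steg_split (m : ℕ) (hm : Odd m) (x : ℕ → ℝ) :
    steg (fun i : Fin m => x (i + 1) + if (i : ℕ) + 1 = m then x 0 else 0) =
      ∑ i ∈ range (m + 1), ∑ j ∈ range (m + 1), ∑ k ∈ range (m + 1),
        evenTriple i j k * (x i * x j * x k) := by
  set a : ℕ → ℝ := fun i => x (i + 1) + if i + 1 = m then x 0 else 0 with ha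
  have h1 : steg (fun i : Fin m => x (i + 1) + if (i : ℕ) + 1 = m then x 0 else 0) =
      ∑ i ∈ range m, ∑ j ∈ range m, ∑ k ∈ range m, evenTriple i j k * (a i * a j * a k) := by
    unfold steg
    rw [← Fin.sum_univ_eq_sum_range (fun i => ∑ j ∈ range m, ∑ k ∈ range m,
      evenTriple i j k * (a i * a j * a k))]
    refine sum_congr rfl fun i _ => ?_
    rw [← Fin.sum_univ_eq_sum_range (fun j => ∑ k ∈ range m,
      evenTriple i j k * (a i * a j * a k))]
    refine sum_congr rfl fun j _ => ?_
    rw [← Fin.sum_univ_eq_sum_range (fun k => evenTriple i j k * (a i * a j * a k))]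
    refine sum_congr rfl fun k _ => ?_
    simp only [evenTriple, Fin.lt_def, ite_mul, one_mul, zero_mul, ha]
  have h2 : ∀ i ∈ range m, ∀ j ∈ range m, ∑ k ∈ range m, evenTriple i j k * (a i * a j * a k) =
      ∑ k ∈ range m, evenTriple i j k * (x (i + 1) * x (j + 1) * x (k + 1)) +
        evenTriple i j (m - 1) * (x (i + 1) * x (j + 1) * x 0) := by
    intro i hi j hj
    have hm0 : m - 1 ∈ range m := by
      rw [mem_range] at hi ⊢; omega
    rw [← sum_ite_eq_of_mem' (range m) (m - 1)
      (fun k => evenTriple i j k * (x (i + 1) * x (j + 1) * x 0)) hm0, ← sum_add_distrib]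
    refine sum_congr rfl fun k hk => ?_
    rw [mem_range] at hi hj hk
    by_cases h : i < j ∧ j < k
    · have e1 : a i = x (i + 1) := by
        simp only [ha]; rw [if_neg (by omega), add_zero]
      have e2 : a j = x (j + 1) := by
        simp only [ha]; rw [if_neg (by omega), add_zero]
      rw [e1, e2]
      simp only [ha]
      by_cases hkm : k + 1 = m
      · rw [if_pos hkm, if_pos (by omega)]; ring
      · rw [if_neg hkm, if_neg (by omega)]; ring
    · have : evenTriple i j k = 0 := by
        unfold evenTriple; rw [if_neg]; tauto
      simp [this]
  rw [h1, sum_congr rfl fun i hi => sum_congr rfl (h2 i hi)]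
  simp_rw [sum_add_distrib]
  rw [sum_range_succ']
  congr 1
  · refine sum_congr rfl fun i _ => ?_
    rw [sum_range_succ']
    have : ∑ k ∈ range (m + 1), evenTriple (i + 1) 0 k * (x (i + 1) * x 0 * x k) = 0 := by
      refine sum_eq_zero fun k _ => ?_
      simp [evenTriple]
    rw [this, add_zero]
    refine sum_congr rfl fun j _ => ?_
    rw [sum_range_succ']
    have : evenTriple (i + 1) (j + 1) 0 = 0 := by simp [evenTriple]
    rw [this, zero_mul, add_zero]
    refine sum_congr rfl fun k _ => ?_
    simp [evenTriple]
  · rw [sum_range_succ']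
    have : ∑ k ∈ range (m + 1), evenTriple 0 0 k * (x 0 * x 0 * x k) = 0 := by
      refine sum_eq_zero fun k _ => ?_
      simp [evenTriple]
    rw [this, add_zero]
    refine sum_congr rfl fun i hi => ?_
    rw [sum_range_succ']
    have : evenTriple 0 (i + 1) 0 = 0 := by simp [evenTriple]
    rw [this, zero_mul, add_zero]
    refine sum_congr rfl fun j hj => ?_
    -- Rotation moves the last index to the front; as `m - 1` is even, both sides require `i` even
    -- and `j` odd.
    have : evenTriple i j (m - 1) = evenTriple 0 (i + 1) (j + 1) := by
      unfold evenTriple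
      congr 1
      rw [mem_range] at hi hj
      simp only [Nat.odd_iff, eq_iff_iff] at hm ⊢
      omega
    rw [this]; ring

open Finset in
theorem sum_mul_edgesBehind {N : ℕ} (A : State N) (F : ℕ → ℝ) :
    ∑ l ∈ range (A.card + 1), F l * edgesBehind A l =
      ∑ x ∈ range N, F (tokensBelow A (x + 1)) := by
  have : ∀ l, (edgesBehind A l : ℝ) =
      ∑ x ∈ range N, if tokensBelow A (x + 1) = l then (1 : ℝ) else 0 := by
    intro l
    simp [edgesBehind]
  simp_rw [this, mul_sum]
  rw [sum_comm]
  refine sum_congr rfl fun x _ => ?_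
  simp only [mul_ite, mul_one, mul_zero]
  rw [sum_ite_eq, if_pos]
  have := tokensBelow_le A (x + 1)
  rw [mem_range]; omega

open Finset in
-- Each gap is a number of edges, so a product of three gaps counts triples of edges.
theorem steg_gaps_eq_sum_evenTriple {N : ℕ} (A : State N) (hA : Odd A.card) :
    steg (gaps A) = ∑ x ∈ range N, ∑ y ∈ range N, ∑ z ∈ range N,
      evenTriple (tokensBelow A (x + 1)) (tokensBelow A (y + 1)) (tokensBelow A (z + 1)) := by
  have h : gaps A = fun i : Fin A.card => (edgesBehind A (i + 1) : ℝ) +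
      if (i : ℕ) + 1 = A.card then (edgesBehind A 0 : ℝ) else 0 := funext (gaps_eq A)
  rw [h, steg_split A.card hA fun l => (edgesBehind A l : ℝ)]
  rw [← sum_mul_edgesBehind A fun i => ∑ y ∈ range N, ∑ z ∈ range N,
    evenTriple i (tokensBelow A (y + 1)) (tokensBelow A (z + 1))]
  refine sum_congr rfl fun i _ => ?_
  rw [← sum_mul_edgesBehind A fun j => ∑ z ∈ range N, evenTriple i j (tokensBelow A (z + 1)),
    sum_mul]
  refine sum_congr rfl fun j _ => ?_
  rw [← sum_mul_edgesBehind A fun k => evenTriple i j k, sum_mul, sum_mul]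
  refine sum_congr rfl fun k _ => ?_
  ring

theorem spin_sq {N : ℕ} (A : State N) (k : ℕ) : spin A k ^ 2 = 1 := by
  rw [spin_eq_pow, ← pow_mul, mul_comm, pow_mul]; simp

theorem spin_mul_eq {N : ℕ} (A : State N) {k l : ℕ} (h : k ≤ l) :
    spin A k * spin A l = if Odd (tokensBelow A l - tokensBelow A k) then -1 else 1 := by
  have h' := tokensBelow_mono A h
  rw [spin_eq_pow, spin_eq_pow, ← pow_add]
  split_ifs with ho
  · exact Odd.neg_one_pow (by rw [Nat.odd_iff] at *; omega)
  · exact Even.neg_one_pow (by rw [Nat.odd_iff] at ho; rw [Nat.even_iff]; omega)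

/-- For signs `a, b, c` the expression `1 - (ab + bc - ac)` is `4` if they alternate and `0`
otherwise. The order of the edges is implied by that of the token counts, which are monotone. -/
theorem evenTriple_tokensBelow {N : ℕ} (A : State N) (x y z : ℕ) :
    evenTriple (tokensBelow A (x + 1)) (tokensBelow A (y + 1)) (tokensBelow A (z + 1)) =
      if x < y ∧ y < z then
        (1 - (spin A (x + 1) * spin A (y + 1) + spin A (y + 1) * spin A (z + 1)
          - spin A (x + 1) * spin A (z + 1))) / 4 else 0 := by
  have lt_of {x y : ℕ} (h : tokensBelow A (x + 1) < tokensBelow A (y + 1)) : x < y := by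
    by_contra hc
    have := tokensBelow_mono A (show y + 1 ≤ x + 1 by omega)
    omega
  split_ifs with h
  · have h1 := tokensBelow_mono A (show x + 1 ≤ y + 1 by omega)
    have h2 := tokensBelow_mono A (show y + 1 ≤ z + 1 by omega)
    have e : spin A (x + 1) * spin A (z + 1) =
        (spin A (x + 1) * spin A (y + 1)) * (spin A (y + 1) * spin A (z + 1)) := by
      linear_combination (-(spin A (x + 1) * spin A (z + 1))) * spin_sq A (y + 1)
    rw [e, spin_mul_eq A (show x + 1 ≤ y + 1 by omega), spin_mul_eq A (show y + 1 ≤ z + 1 by omega)]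
    unfold evenTriple
    by_cases o1 : Odd (tokensBelow A (y + 1) - tokensBelow A (x + 1)) <;>
    by_cases o2 : Odd (tokensBelow A (z + 1) - tokensBelow A (y + 1))
    · have p1 := o1.pos
      have p2 := o2.pos
      rw [if_pos ⟨by omega, by omega, o1, o2⟩]; simp [o1, o2]; norm_num
    all_goals simp [o1, o2]
  · unfold evenTriple
    rw [if_neg]
    rintro ⟨h1, h2, -⟩
    exact h ⟨lt_of h1, lt_of h2⟩

open Finset in
theorem sum_range_ite_lt {n m : ℕ} (h : m ≤ n) (f : ℕ → ℝ) :
    (∑ y ∈ range n, if y < m then f y else 0) = ∑ y ∈ range m, f y := by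
  rw [← sum_filter]
  congr 1
  ext y
  simp only [mem_filter, mem_range]
  omega

open Finset in
/-- `steg` of the gap vector as a quadratic form in the spins. -/
theorem steg_gaps_eq {N : ℕ} (A : State N) (hA : Odd A.card) :
    steg (gaps A) = (∑ w ∈ range N, ∑ v ∈ range w, ∑ _u ∈ range v, (1 : ℝ)) / 4 -
      (∑ v ∈ range N, ∑ u ∈ range v,
        ((N : ℝ) - 2 * ((v : ℝ) - u)) * (spin A (u + 1) * spin A (v + 1))) / 4 := by
  rw [← sum_triple_pair_terms fun u v => spin A (u + 1) * spin A (v + 1), ← sub_div]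
  simp_rw [← sum_sub_distrib]
  rw [steg_gaps_eq_sum_evenTriple A hA]
  simp_rw [evenTriple_tokensBelow]
  rw [sum_comm, sum_congr rfl fun y _ => sum_comm, sum_comm, sum_div]
  refine sum_congr rfl fun z hz => ?_
  rw [sum_div, ← sum_range_ite_lt (mem_range.1 hz).le]
  refine sum_congr rfl fun y hy => ?_
  by_cases h : y < z
  · rw [if_pos h, sum_div, ← sum_range_ite_lt (mem_range.1 hy).le]
    refine sum_congr rfl fun x hx => ?_
    simp only [h, and_true]
  · simp [h]

/-! ### The effect of one step -/

theorem prod_symmDiff_of_sq_eq_one {α : Type*} [DecidableEq α] (S T : Finset α) (f : α → ℝ)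
    (hf : ∀ a, f a * f a = 1) :
    ∏ a ∈ symmDiff S T, f a = (∏ a ∈ S, f a) * ∏ a ∈ T, f a := by
  have h : Disjoint (S \ T) (T \ S) := by
    rw [Finset.disjoint_left]
    intro a ha hb
    simp only [Finset.mem_sdiff] at ha hb
    exact ha.2 hb.1
  have hi : (∏ a ∈ S ∩ T, f a) * ∏ a ∈ S ∩ T, f a = 1 := by
    rw [← Finset.prod_mul_distrib]
    exact Finset.prod_eq_one fun a _ => hf a
  rw [symmDiff_def, Finset.sup_eq_union, Finset.prod_union h, ← Finset.prod_inter_mul_prod_sdiff S T,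
    ← Finset.prod_inter_mul_prod_sdiff T S, Finset.inter_comm T S]
  linear_combination (-(∏ a ∈ S \ T, f a) * ∏ a ∈ T \ S, f a) * hi

theorem prod_sdiff_of_sq_eq_one {α : Type*} [DecidableEq α] {P A : Finset α} (h : P ⊆ A)
    (f : α → ℝ) (hf : ∀ a, f a * f a = 1) :
    ∏ a ∈ A \ P, f a = (∏ a ∈ A, f a) * ∏ a ∈ P, f a := by
  have hi : (∏ a ∈ P, f a) * ∏ a ∈ P, f a = 1 := by
    rw [← Finset.prod_mul_distrib]
    exact Finset.prod_eq_one fun a _ => hf a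
  rw [← Finset.prod_sdiff h, mul_assoc, hi, mul_one]

/-- Products of signs do not see annihilation: two tokens on one processor contribute `f a * f a =
1`. The constant `-1` gives parity conservation, threshold signs give the spins. -/
theorem prod_move {N : ℕ} [NeZero N] {A P : State N} (h : P ⊆ A) (f : Fin N → ℝ) (hf : ∀ a, f a * f a = 1) :
    ∏ a ∈ move A P, f a = (∏ a ∈ A, f a) * ∏ a ∈ P, f a * f (a + 1) := by
  unfold move
  rw [prod_symmDiff_of_sq_eq_one _ _ f hf, prod_sdiff_of_sq_eq_one h f hf,
    Finset.prod_image fun a _ b _ hab => add_right_cancel hab, Finset.prod_mul_distrib, mul_assoc]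

theorem odd_card_move {N : ℕ} [NeZero N] {A P : State N} (h : P ⊆ A) (hA : Odd A.card) : Odd (move A P).card := by
  have := prod_move h (fun _ => (-1 : ℝ)) (by norm_num)
  simp only [Finset.prod_const, hA.neg_one_pow] at this
  rw [← neg_one_pow_eq_neg_one_iff_odd (R := ℝ) (by norm_num), this]
  norm_num

theorem card_move_le {N : ℕ} [NeZero N] {A P : State N} (h : P ⊆ A) : (move A P).card ≤ A.card := by
  calc (move A P).card ≤ (A \ P ∪ P.image fun x => x + 1).card := by
        refine Finset.card_le_card fun a ha => ?_
        simp only [move, Finset.mem_symmDiff, Finset.mem_union] at ha ⊢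
        tauto
    _ ≤ (A \ P).card + P.card :=
        (Finset.card_union_le _ _).trans (Nat.add_le_add_left Finset.card_image_le _)
    _ = A.card := Finset.card_sdiff_add_card_eq_card h

theorem IsStable.move {N : ℕ} [NeZero N] {A P : State N} (h : P ⊆ A) (hA : IsStable A) : IsStable (move A P) := by
  unfold IsStable at *
  have h1 := card_move_le h
  have h2 := (odd_card_move h (by rw [hA]; exact odd_one)).pos
  omega

theorem val_add_one_eq {N : ℕ} [NeZero N] (p : Fin N) :
    ((p + 1 : Fin N) : ℕ) = if (p : ℕ) + 1 = N then 0 else (p : ℕ) + 1 := by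
  have hp := p.2
  have : ((p + 1 : Fin N) : ℕ) = ((p : ℕ) + 1) % N := by
    rw [Fin.val_add, Fin.val_one', Nat.add_mod_mod]
  rw [this]
  split_ifs with h
  · rw [h, Nat.mod_self]
  · exact Nat.mod_eq_of_lt (by omega)

theorem spin_succ {N : ℕ} (A : State N) {u : ℕ} (hu : u < N) :
    spin A (u + 1) = spin A u * if (⟨u, hu⟩ : Fin N) ∈ A then -1 else 1 := by
  have : (if (⟨u, hu⟩ : Fin N) ∈ A then (-1 : ℝ) else 1) =
      ∏ a ∈ A, if a = ⟨u, hu⟩ then -1 else 1 := by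
    rw [Finset.prod_ite_eq']
  rw [this]
  unfold spin
  rw [← Finset.prod_mul_distrib]
  refine Finset.prod_congr rfl fun a _ => ?_
  have : a = ⟨u, hu⟩ ↔ (a : ℕ) = u := Fin.ext_iff
  simp only [this]
  rcases lt_trichotomy (a : ℕ) u with h | h | h
  · simp [h, h.ne, h.trans (Nat.lt_succ_self u)]
  · simp [h]
  · rw [if_neg (by omega), if_neg (by omega), if_neg (by omega)]; ring

/-- Passing the tokens in `P` flips the spins at the edges behind them, up to a global sign. -/
theorem spin_move {N : ℕ} [NeZero N] {A P : State N} (h : P ⊆ A) {x : ℕ} (hx : x < N) :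
    spin (move A P) (x + 1) =
      spin A (x + 1) * (∏ p ∈ P, if (p : ℕ) = x then -1 else 1) *
        ∏ p ∈ P, if (p : ℕ) + 1 = N then -1 else 1 := by
  unfold spin
  rw [prod_move h, mul_assoc, ← Finset.prod_mul_distrib]
  · congr 1
    refine Finset.prod_congr rfl fun p _ => ?_
    rw [val_add_one_eq]
    have hp := p.2
    -- A token passed across the origin flips every spin except that of the last edge; this is the
    -- global sign times the flip at its own edge.
    by_cases h1 : (p : ℕ) + 1 = N
    · by_cases h2 : (p : ℕ) = x
      · rw [if_pos (by omega), if_pos (by split_ifs; omega), if_pos h2, if_pos h1]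
      · rw [if_neg (by omega), if_pos (by split_ifs; omega), if_neg h2, if_pos h1]
    · simp only [h1, if_false]
      rcases lt_trichotomy (p : ℕ) x with h2 | h2 | h2
      · rw [if_pos (by omega), if_pos (by omega), if_neg (by omega)]; ring
      · rw [if_pos (by omega), if_neg (by omega), if_pos (by omega)]
      · rw [if_neg (by omega), if_neg (by omega), if_neg (by omega)]
  · intro a
    split_ifs <;> norm_num

/-- The global sign cancels in the product. The sum over `P` then factors over tokens: a token at
`u` or `v` yields the factor `1 - 1`, every other token the factor `2`. On the right, the average of
a spin and its predecessor vanishes exactly when a token separates them. -/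
theorem sum_powerset_spin_move {N : ℕ} [NeZero N] (A : State N) {u v : ℕ} (hu : u < N) (hv : v < N) (huv : u ≠ v) :
    ∑ P ∈ A.powerset, spin (move A P) (u + 1) * spin (move A P) (v + 1) =
      2 ^ A.card / 4 * ((spin A u + spin A (u + 1)) * (spin A v + spin A (v + 1))) := by
  have h1 : ∀ P ∈ A.powerset, spin (move A P) (u + 1) * spin (move A P) (v + 1) =
      spin A (u + 1) * spin A (v + 1) *
        ∏ p ∈ P, (if (p : ℕ) = u then (-1 : ℝ) else 1) * if (p : ℕ) = v then -1 else 1 := by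
    intro P hP
    rw [Finset.mem_powerset] at hP
    rw [spin_move hP hu, spin_move hP hv, Finset.prod_mul_distrib]
    have : (∏ p ∈ P, if (p : ℕ) + 1 = N then (-1 : ℝ) else 1) *
        (∏ p ∈ P, if (p : ℕ) + 1 = N then (-1 : ℝ) else 1) = 1 := by
      rw [← Finset.prod_mul_distrib]
      refine Finset.prod_eq_one fun p _ => ?_
      split_ifs <;> norm_num
    linear_combination (spin A (u + 1) * (∏ p ∈ P, if (p : ℕ) = u then (-1 : ℝ) else 1) *
      (spin A (v + 1) * ∏ p ∈ P, if (p : ℕ) = v then (-1 : ℝ) else 1)) * this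
  rw [Finset.sum_congr rfl h1, ← Finset.mul_sum, ← Finset.prod_one_add]
  rw [spin_succ A hu, spin_succ A hv]
  by_cases h2 : (⟨u, hu⟩ : Fin N) ∈ A
  · rw [Finset.prod_eq_zero h2 (by simp [huv])]
    simp [h2]
  by_cases h3 : (⟨v, hv⟩ : Fin N) ∈ A
  · rw [Finset.prod_eq_zero h3 (by simp [huv.symm])]
    simp [h3]
  have : ∀ p ∈ A, 1 + (if (p : ℕ) = u then (-1 : ℝ) else 1) * (if (p : ℕ) = v then -1 else 1) = 2 := by
    intro p hp
    rw [if_neg (by rintro rfl; exact h2 hp), if_neg (by rintro rfl; exact h3 hp)]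
    norm_num
  rw [Finset.prod_congr rfl this, Finset.prod_const, if_neg h2, if_neg h3]
  ring

theorem spin_zero {N : ℕ} (A : State N) : spin A 0 = 1 := by simp [spin]

theorem spin_length {N : ℕ} (A : State N) (hA : Odd A.card) : spin A N = -1 := by
  simp [spin, hA.neg_one_pow]

/-- Consecutive spins differ exactly across a token. -/
theorem sum_spin_mul_spin_succ {N : ℕ} (A : State N) :
    ∑ v ∈ Finset.range N, spin A v * spin A (v + 1) = N - 2 * A.card := by
  rw [← Fin.sum_univ_eq_sum_range (fun v => spin A v * spin A (v + 1))]
  have : ∀ v : Fin N, spin A v * spin A (v + 1) = 1 - 2 * if v ∈ A then 1 else 0 := by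
    intro v
    rw [spin_succ A v.2, ← mul_assoc, ← sq, spin_sq]
    simp only [Fin.eta]
    split_ifs <;> norm_num
  simp_rw [this]
  simp [Finset.sum_sub_distrib, mul_comm]

open Finset in
/-- One step of the algorithm lowers the expected value of `steg` by `N / 4` times its cost. -/
theorem sum_powerset_steg_move {N : ℕ} [NeZero N] (A : State N) (hA : Odd A.card) :
    ∑ P ∈ A.powerset, steg (gaps (move A P)) =
      2 ^ A.card * (steg (gaps A) - N / 4 * stepCost A) := by
  rw [sum_congr rfl fun P hP => steg_gaps_eq (move A P)
    (odd_card_move (mem_powerset.1 hP) hA)]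
  rw [sum_sub_distrib, sum_const, card_powerset, ← sum_div, sum_comm, nsmul_eq_mul,
    steg_gaps_eq A hA]
  have h1 : ∑ v ∈ range N, ∑ P ∈ A.powerset, ∑ u ∈ range v, ((N : ℝ) - 2 * ((v : ℝ) - u)) *
        (spin (move A P) (u + 1) * spin (move A P) (v + 1)) =
      2 ^ A.card / 4 * ∑ v ∈ range N, ∑ u ∈ range v, ((N : ℝ) - 2 * ((v : ℝ) - u)) *
        ((spin A u + spin A (u + 1)) * (spin A v + spin A (v + 1))) := by
    rw [mul_sum]
    refine sum_congr rfl fun v hv => ?_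
    rw [sum_comm, mul_sum]
    refine sum_congr rfl fun u hu => ?_
    rw [mem_range] at hu hv
    rw [← mul_sum, sum_powerset_spin_move A (hu.trans hv) hv hu.ne]
    ring
  have h2 := sum_averaged_sub_of_antiperiodic (spin A) N (spin_sq A)
    (by rw [spin_length A hA, spin_zero])
  rw [sum_spin_mul_spin_succ] at h2
  simp_rw [mul_sub, sum_sub_distrib] at h2
  have h3 : ∑ v ∈ range N, ∑ u ∈ range v, ((N : ℝ) - 2 * ((v : ℝ) - u)) *
        (4 * (spin A (u + 1) * spin A (v + 1))) =
      4 * ∑ v ∈ range N, ∑ u ∈ range v, ((N : ℝ) - 2 * ((v : ℝ) - u)) *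
        (spin A (u + 1) * spin A (v + 1)) := by
    simp_rw [mul_sum]
    refine sum_congr rfl fun v _ => sum_congr rfl fun u _ => ?_
    ring
  simp_rw [mul_sub] at h1 h3 ⊢
  rw [h3] at h2
  rw [h1]
  unfold stepCost
  push_cast
  linear_combination (-(2 : ℝ) ^ A.card / 16) * h2

theorem steg_gaps_nonneg {N : ℕ} (A : State N) (hA : Odd A.card) : 0 ≤ steg (gaps A) := by
  rw [steg_gaps_eq_sum_evenTriple A hA]
  refine Finset.sum_nonneg fun x _ => Finset.sum_nonneg fun y _ => Finset.sum_nonneg fun z _ => ?_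
  unfold evenTriple
  split_ifs <;> norm_num

theorem steg_gaps_of_isStable {N : ℕ} {A : State N} (hA : IsStable A) : steg (gaps A) = 0 := by
  unfold steg
  refine Finset.sum_eq_zero fun i _ => Finset.sum_eq_zero fun j _ => Finset.sum_eq_zero fun k _ => ?_
  unfold IsStable at hA
  rw [if_neg]
  rintro ⟨h, -⟩
  have : (i : ℕ) < j := h
  omega

/-! ### Transition probabilities and step costs -/

theorem stepLaw_eq {N : ℕ} [NeZero N] (A : State N) :
    stepLaw A =
      (PMF.uniformOfFinset A.powerset (Finset.powerset_nonempty A)).map (move A) :=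
  rfl

theorem toReal_stepLaw {N : ℕ} [NeZero N] (B C : State N) :
    (stepLaw B C).toReal =
      ((2 : ℝ) ^ B.card)⁻¹ * ∑ P ∈ B.powerset, if C = move B P then 1 else 0 := by
  rw [stepLaw_eq, PMF.map_apply, tsum_fintype, ENNReal.toReal_sum, Finset.mul_sum,
    ← Finset.sum_subset (Finset.subset_univ B.powerset)]
  · refine Finset.sum_congr rfl fun P hP => ?_
    split_ifs
    · rw [PMF.uniformOfFinset_apply_of_mem _ hP]; simp
    · simp
  · intro P _ hP
    rw [PMF.uniformOfFinset_apply_of_notMem _ hP]; simp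
  · intro P _
    split_ifs
    · exact PMF.apply_ne_top _ _
    · simp

theorem sum_toReal_stepLaw_mul {N : ℕ} [NeZero N] (B : State N) (f : State N → ℝ) :
    ∑ C, (stepLaw B C).toReal * f C = ((2 : ℝ) ^ B.card)⁻¹ * ∑ P ∈ B.powerset, f (move B P) := by
  simp_rw [toReal_stepLaw, mul_assoc]
  rw [← Finset.mul_sum]
  simp_rw [Finset.sum_mul]
  rw [Finset.sum_comm]
  simp

theorem exists_of_stepLaw_ne_zero {N : ℕ} [NeZero N] {B C : State N} (h : stepLaw B C ≠ 0) :
    ∃ P ⊆ B, C = move B P := by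
  rw [← PMF.mem_support_iff, stepLaw_eq] at h
  obtain ⟨P, hP, rfl⟩ := (PMF.mem_support_map_iff _ _ _).1 h
  rw [PMF.mem_support_uniformOfFinset_iff, Finset.mem_powerset] at hP
  exact ⟨P, hP, rfl⟩

theorem stepCost_nonneg {N : ℕ} {A : State N} (hA : Odd A.card) : 0 ≤ stepCost A := by
  have : (1 : ℝ) ≤ A.card := by exact_mod_cast hA.pos
  unfold stepCost
  linarith

/-- By parity an unstable state has at least three tokens. -/
theorem one_le_stepCost {N : ℕ} {A : State N} (hA : Odd A.card) (h : ¬ IsStable A) :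
    1 ≤ stepCost A := by
  have : 3 ≤ A.card := by
    unfold IsStable at h
    obtain ⟨k, hk⟩ := hA
    omega
  have : (3 : ℝ) ≤ A.card := by exact_mod_cast this
  unfold stepCost
  linarith

theorem stepCost_of_isStable {N : ℕ} {A : State N} (h : IsStable A) : stepCost A = 0 := by
  unfold IsStable at h
  simp [stepCost, h]

/-! ### Runs as random processes -/

namespace IsRun

variable {N : ℕ} [NeZero N] {Ω : Type*} [MeasurableSpace Ω] {μ : Measure Ω}
  {A : ℕ → Ω → State N} {A₀ : State N}

theorem measurableSet_cylinder (hA : IsRun μ A A₀) (t : ℕ) (x : ℕ → State N) :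
    MeasurableSet {ω | ∀ s ≤ t, A s ω = x s} := by
  simp only [Set.ofPred_forall]
  exact MeasurableSet.iInter fun s => MeasurableSet.iInter fun _ => hA.measurable s (x s)

theorem measure_transition (hA : IsRun μ A A₀) (t : ℕ) (B C : State N) :
    μ {ω | A t ω = B ∧ A (t + 1) ω = C} = μ {ω | A t ω = B} * stepLaw B C := by
  -- The event is split into cylinders: histories `y` before time `t`, followed by `B` and then `C`.
  let x : (Fin t → State N) → ℕ → State N := fun y s =>
    if h : s < t then y ⟨s, h⟩ else if s = t then B else C
  have xlt : ∀ (y) (s) (h : s < t), x y s = y ⟨s, h⟩ := fun y s h => by simp [x, h]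
  have xt : ∀ y, x y t = B := fun y => by simp [x]
  have xt1 : ∀ y, x y (t + 1) = C := fun y => by simp [x]
  have h1 : {ω | A t ω = B} = ⋃ y, {ω | ∀ s ≤ t, A s ω = x y s} := by
    ext ω
    simp only [Set.mem_ofPred_eq, Set.mem_iUnion]
    constructor
    · intro h
      let y : Fin t → State N := fun s => A s ω
      refine ⟨y, fun s hs => ?_⟩
      rcases hs.lt_or_eq with hs | rfl
      · exact (xlt y s hs).symm
      · exact h.trans (xt y).symm
    · rintro ⟨y, h⟩
      rw [h t le_rfl, xt]
  have h2 : {ω | A t ω = B ∧ A (t + 1) ω = C} = ⋃ y, {ω | ∀ s ≤ t + 1, A s ω = x y s} := by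
    ext ω
    simp only [Set.mem_ofPred_eq, Set.mem_iUnion]
    constructor
    · rintro ⟨h, h'⟩
      let y : Fin t → State N := fun s => A s ω
      refine ⟨y, fun s hs => ?_⟩
      rcases hs.lt_or_eq with hs | rfl
      · rcases (Nat.lt_succ_iff.1 hs).lt_or_eq with hs | rfl
        · exact (xlt y s hs).symm
        · exact h.trans (xt y).symm
      · exact h'.trans (xt1 y).symm
    · rintro ⟨y, h⟩
      rw [h t (Nat.le_succ t), h (t + 1) le_rfl, xt, xt1]
      exact ⟨rfl, rfl⟩
  have hd : ∀ r, t ≤ r →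
      Pairwise (Function.onFun Disjoint fun y => {ω | ∀ s ≤ r, A s ω = x y s}) := by
    intro r hr y y' hy
    rw [Function.onFun, Set.disjoint_left]
    intro ω h h'
    refine hy (funext fun s => ?_)
    have e := h s (s.2.le.trans hr)
    have e' := h' s (s.2.le.trans hr)
    rw [xlt _ _ s.2] at e e'
    exact e.symm.trans e'
  rw [h1, h2, measure_iUnion (hd _ (Nat.le_succ t)) fun y => hA.measurableSet_cylinder _ _,
    measure_iUnion (hd _ le_rfl) fun y => hA.measurableSet_cylinder _ _, ← ENNReal.tsum_mul_right]
  refine tsum_congr fun y => ?_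
  rw [hA.markov, xt, xt1]

/-- There are countably many times and finitely many pairs of states, so the null events of
forbidden transitions can be discarded together. -/
theorem ae_move (hA : IsRun μ A A₀) :
    ∀ᵐ ω ∂μ, ∀ t, ∃ P ⊆ A t ω, A (t + 1) ω = move (A t ω) P := by
  rw [ae_all_iff]
  intro t
  have : ∀ᵐ ω ∂μ, ∀ B C, A t ω = B ∧ A (t + 1) ω = C → ∃ P ⊆ B, C = move B P := by
    rw [ae_all_iff]
    intro B
    rw [ae_all_iff]
    intro C
    by_cases h : stepLaw B C = 0
    · have h0 : μ {ω | A t ω = B ∧ A (t + 1) ω = C} = 0 := by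
        rw [hA.measure_transition, h, mul_zero]
      filter_upwards [measure_eq_zero_iff_ae_notMem.1 h0] with ω hω h'
      exact absurd h' hω
    · exact Filter.Eventually.of_forall fun ω _ => exists_of_stepLaw_ne_zero h
  filter_upwards [this] with ω h
  exact h _ _ ⟨rfl, rfl⟩

theorem ae_odd (hA : IsRun μ A A₀) (hA₀ : Odd A₀.card) : ∀ᵐ ω ∂μ, ∀ t, Odd (A t ω).card := by
  filter_upwards [hA.ae_move, hA.start] with ω h h0 t
  induction t with
  | zero => rw [h0]; exact hA₀
  | succ t ih =>
    obtain ⟨P, hP, e⟩ := h t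
    rw [e]
    exact odd_card_move hP ih

theorem ae_isStable_of_le (hA : IsRun μ A A₀) :
    ∀ᵐ ω ∂μ, ∀ s, IsStable (A s ω) → ∀ t ≥ s, IsStable (A t ω) := by
  filter_upwards [hA.ae_move] with ω h s hs t ht
  induction t, ht using Nat.le_induction with
  | base => exact hs
  | succ t _ ih =>
    obtain ⟨P, hP, e⟩ := h t
    rw [e]
    exact ih.move hP

theorem measurable_comp (hA : IsRun μ A A₀) (t : ℕ) (f : State N → ℝ) :
    Measurable fun ω => f (A t ω) := by
  let _ : MeasurableSpace (State N) := ⊤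
  have : Measurable (A t) := measurable_to_countable' fun B => hA.measurable t B
  exact measurable_from_top.comp this

theorem integral_comp [IsProbabilityMeasure μ] (hA : IsRun μ A A₀) (t : ℕ) (f : State N → ℝ) :
    ∫ ω, f (A t ω) ∂μ = ∑ B, μ.real {ω | A t ω = B} * f B := by
  have : ∀ ω, f (A t ω) = ∑ B, {ω | A t ω = B}.indicator (fun _ => f B) ω := by
    intro ω
    simp [Set.indicator_apply]
  simp_rw [this]
  rw [integral_finsetSum]
  · refine Finset.sum_congr rfl fun B _ => ?_
    rw [integral_indicator_const _ (hA.measurable t B), smul_eq_mul]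
  · intro B _
    exact (integrable_const _).indicator (hA.measurable t B)

theorem integrable_comp [IsProbabilityMeasure μ] (hA : IsRun μ A A₀) (t : ℕ) (f : State N → ℝ) :
    Integrable (fun ω => f (A t ω)) μ := by
  refine Integrable.of_bound (hA.measurable_comp t f).aestronglyMeasurable (∑ B, ‖f B‖)
    (Filter.Eventually.of_forall fun ω => ?_)
  exact Finset.single_le_sum (f := fun B => ‖f B‖) (fun _ _ => norm_nonneg _) (Finset.mem_univ _)

theorem integral_comp_succ [IsProbabilityMeasure μ] (hA : IsRun μ A A₀) (t : ℕ)
    (f : State N → ℝ) :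
    ∫ ω, f (A (t + 1) ω) ∂μ =
      ∫ ω, ((2 : ℝ) ^ (A t ω).card)⁻¹ * ∑ P ∈ (A t ω).powerset, f (move (A t ω) P) ∂μ := by
  rw [hA.integral_comp, hA.integral_comp t fun B =>
    ((2 : ℝ) ^ B.card)⁻¹ * ∑ P ∈ B.powerset, f (move B P)]
  simp_rw [← sum_toReal_stepLaw_mul]
  have : ∀ C, μ.real {ω | A (t + 1) ω = C} =
      ∑ B, μ.real {ω | A t ω = B} * (stepLaw B C).toReal := by
    intro C
    have hU : {ω | A (t + 1) ω = C} = ⋃ B, {ω | A t ω = B ∧ A (t + 1) ω = C} := by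
      ext ω; simp
    rw [hU, measureReal_iUnion_fintype]
    · refine Finset.sum_congr rfl fun B _ => ?_
      rw [Measure.real, hA.measure_transition, ENNReal.toReal_mul, Measure.real]
    · intro B B' h
      rw [Function.onFun, Set.disjoint_left]
      rintro ω ⟨h1, -⟩ ⟨h2, -⟩
      exact h (h1.symm.trans h2)
    · intro B
      exact (hA.measurable t B).inter (hA.measurable (t + 1) C)
  simp_rw [this, Finset.sum_mul, Finset.mul_sum]
  rw [Finset.sum_comm]
  simp_rw [mul_assoc]

/-! ### Telescoping, stabilisation and the total cost -/

theorem integral_steg_succ [IsProbabilityMeasure μ] (hA : IsRun μ A A₀) (hA₀ : Odd A₀.card)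
    (t : ℕ) :
    ∫ ω, steg (gaps (A (t + 1) ω)) ∂μ =
      ∫ ω, steg (gaps (A t ω)) ∂μ - N / 4 * ∫ ω, stepCost (A t ω) ∂μ := by
  rw [hA.integral_comp_succ t fun B => steg (gaps B), ← integral_const_mul, ← integral_sub
    (hA.integrable_comp t fun B => steg (gaps B)) ((hA.integrable_comp t stepCost).const_mul _)]
  refine integral_congr_ae ?_
  filter_upwards [hA.ae_odd hA₀] with ω h
  rw [sum_powerset_steg_move _ (h t), inv_mul_cancel_left₀ (by positivity)]

open Filter Topology in
theorem hasSum_integral_stepCost [IsProbabilityMeasure μ] (hA : IsRun μ A A₀)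
    (hA₀ : Odd A₀.card) :
    HasSum (fun t => ∫ ω, stepCost (A t ω) ∂μ) (4 / (N : ℝ) * steg (gaps A₀)) := by
  have hN : (N : ℝ) ≠ 0 := by exact_mod_cast NeZero.ne N
  set k : ℕ → ℝ := fun t => ∫ ω, stepCost (A t ω) ∂μ with hk
  set e : ℕ → ℝ := fun t => ∫ ω, steg (gaps (A t ω)) ∂μ with he
  have hk0 : ∀ t, 0 ≤ k t := fun t => integral_nonneg_of_ae <| by
    filter_upwards [hA.ae_odd hA₀] with ω h using stepCost_nonneg (h t)
  have he0 : ∀ t, 0 ≤ e t := fun t => integral_nonneg_of_ae <| by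
    filter_upwards [hA.ae_odd hA₀] with ω h using steg_gaps_nonneg _ (h t)
  have hstart : e 0 = steg (gaps A₀) := by
    have : e 0 = ∫ _, steg (gaps A₀) ∂μ := integral_congr_ae <| by
      filter_upwards [hA.start] with ω h
      rw [h]
    rw [this]; simp
  have hsum : ∀ n, ∑ t ∈ Finset.range n, k t = 4 / (N : ℝ) * (steg (gaps A₀) - e n) := by
    intro n
    induction n with
    | zero => simp [hstart]
    | succ n ih =>
      rw [Finset.sum_range_succ, ih]
      have : e (n + 1) = e n - N / 4 * k n := hA.integral_steg_succ hA₀ n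
      rw [this]
      field_simp
      ring
  have hsummable : Summable k := by
    refine summable_of_sum_range_le hk0 (c := 4 / (N : ℝ) * steg (gaps A₀)) fun n => ?_
    rw [hsum]
    have := he0 n
    gcongr
    linarith
  -- Both `steg` and the cost vanish at stable states; elsewhere the cost is at least `1` and the
  -- finite sum bounds `steg`. This gives decay of `e` before stabilisation is known.
  have hle : ∀ t, e t ≤ (∑ B : State N, |steg (gaps B)|) * k t := by
    intro t
    simp only [he, hk]
    rw [← integral_const_mul]
    refine integral_mono_ae (hA.integrable_comp t fun B => steg (gaps B))
      ((hA.integrable_comp t stepCost).const_mul _) ?_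
    filter_upwards [hA.ae_odd hA₀] with ω h
    by_cases hs : IsStable (A t ω)
    · rw [steg_gaps_of_isStable hs, stepCost_of_isStable hs, mul_zero]
    · have h1 : |steg (gaps (A t ω))| ≤ ∑ B : State N, |steg (gaps B)| :=
        Finset.single_le_sum (f := fun B : State N => |steg (gaps B)|)
          (fun _ _ => abs_nonneg _) (Finset.mem_univ _)
      have h2 := one_le_stepCost (h t) hs
      have h3 := le_abs_self (steg (gaps (A t ω)))
      have h4 := abs_nonneg (steg (gaps (A t ω)))
      calc steg (gaps (A t ω)) ≤ (∑ B : State N, |steg (gaps B)|) * 1 := by linarith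
        _ ≤ _ := mul_le_mul_of_nonneg_left h2 (by linarith)
  have hlim : Tendsto e atTop (𝓝 0) := by
    refine squeeze_zero he0 hle ?_
    simpa using hsummable.tendsto_atTop_zero.const_mul (∑ B : State N, |steg (gaps B)|)
  rw [hasSum_iff_tendsto_nat_of_nonneg hk0]
  simp_rw [hsum]
  simpa using (hlim.const_sub (steg (gaps A₀))).const_mul (4 / (N : ℝ))

theorem lintegral_tsum_stepCost [IsProbabilityMeasure μ] (hA : IsRun μ A A₀)
    (hA₀ : Odd A₀.card) :
    ∫⁻ ω, ∑' t, ENNReal.ofReal (stepCost (A t ω)) ∂μ =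
      ENNReal.ofReal (4 / (N : ℝ) * steg (gaps A₀)) := by
  have h := hA.hasSum_integral_stepCost hA₀
  have hpos : ∀ t, 0 ≤ᵐ[μ] fun ω => stepCost (A t ω) := fun t => by
    filter_upwards [hA.ae_odd hA₀] with ω h using stepCost_nonneg (h t)
  rw [lintegral_tsum fun t => (hA.measurable_comp t stepCost).ennreal_ofReal.aemeasurable,
    ← h.tsum_eq, ENNReal.ofReal_tsum_of_nonneg (fun t => integral_nonneg_of_ae (hpos t)) h.summable]
  exact tsum_congr fun t =>
    (ofReal_integral_eq_lintegral_ofReal (hA.integrable_comp t stepCost) (hpos t)).symm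

/-- A run that never stabilises pays at least `1` at every step, hence has infinite cost; finite
expectation makes this a null event. -/
theorem ae_exists_isStable [IsProbabilityMeasure μ] (hA : IsRun μ A A₀) (hA₀ : Odd A₀.card) :
    ∀ᵐ ω ∂μ, ∃ t, IsStable (A t ω) := by
  have hfin := ae_lt_top' (μ := μ) (f := fun ω => ∑' t, ENNReal.ofReal (stepCost (A t ω)))
    (AEMeasurable.tsum fun t =>
      (hA.measurable_comp t stepCost).ennreal_ofReal.aemeasurable)
    (by rw [hA.lintegral_tsum_stepCost hA₀]; exact ENNReal.ofReal_ne_top)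
  filter_upwards [hfin, hA.ae_odd hA₀] with ω hω hodd
  by_contra! hs
  refine hω.ne (top_unique ?_)
  rw [← ENNReal.tsum_const_eq_top_of_ne_zero (α := ℕ) one_ne_zero]
  refine ENNReal.tsum_le_tsum fun t => ?_
  rw [ENNReal.one_le_ofReal]
  exact one_le_stepCost (hodd t) (hs t)

theorem ae_cost_eq_totalCost [IsProbabilityMeasure μ] (hA : IsRun μ A A₀)
    (hA₀ : Odd A₀.card) :
    ∀ᵐ ω ∂μ, ∀ t ≥ stabTime A ω, cost A t ω = totalCost A ω := by
  filter_upwards [hA.ae_exists_isStable hA₀, hA.ae_isStable_of_le] with ω hex hst t ht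
  have hT : IsStable (A (stabTime A ω) ω) := Nat.sInf_mem hex
  unfold totalCost cost
  refine (Finset.sum_subset (Finset.range_mono ht) fun s _ hs => ?_).symm
  exact stepCost_of_isStable (hst _ hT s (by simpa using hs))

/-- Stable states persist and cost nothing, so the stopped sum is the full series. This transfers
integrability and the expectation from the series to `totalCost`. -/
theorem ae_totalCost_eq_tsum [IsProbabilityMeasure μ] (hA : IsRun μ A A₀)
    (hA₀ : Odd A₀.card) :
    ∀ᵐ ω ∂μ, (∑' t, ENNReal.ofReal (stepCost (A t ω))).toReal = totalCost A ω := by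
  filter_upwards [hA.ae_exists_isStable hA₀, hA.ae_isStable_of_le, hA.ae_odd hA₀]
    with ω hex hst hodd
  have hT : IsStable (A (stabTime A ω) ω) := Nat.sInf_mem hex
  have h0 : ∀ s, 0 ≤ stepCost (A s ω) := fun s => stepCost_nonneg (hodd s)
  unfold totalCost cost
  rw [tsum_eq_sum (s := Finset.range (stabTime A ω)), ← ENNReal.ofReal_sum_of_nonneg fun s _ => h0 s,
    ENNReal.toReal_ofReal (Finset.sum_nonneg fun s _ => h0 s)]
  intro s hs
  rw [stepCost_of_isStable (hst _ hT s (by simpa using hs)), ENNReal.ofReal_zero]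

end IsRun

end Herman

theorem mainTheorem2 {N : ℕ} [NeZero N] (A₀ : Herman.State N) (hA₀ : Odd A₀.card)
    {Ω : Type*} [MeasurableSpace Ω] (μ : Measure Ω) [IsProbabilityMeasure μ]
    (A : ℕ → Ω → Herman.State N) (hA : Herman.IsRun μ A A₀) :
    (∀ᵐ ω ∂μ, (∃ t, Herman.IsStable (A t ω)) ∧
      ∀ t ≥ Herman.stabTime A ω, Herman.cost A t ω = Herman.totalCost A ω) ∧
    Integrable (Herman.totalCost A) μ ∧
    ∫ ω, Herman.totalCost A ω ∂μ = 4 / (N : ℝ) * Herman.steg (Herman.gaps A₀) := by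
  have hmeas : AEMeasurable
      (fun ω => ∑' t, ENNReal.ofReal (Herman.stepCost (A t ω))) μ :=
    AEMeasurable.tsum fun t =>
      (hA.measurable_comp t Herman.stepCost).ennreal_ofReal.aemeasurable
  have hlint := hA.lintegral_tsum_stepCost hA₀
  have hfin : ∫⁻ ω, ∑' t, ENNReal.ofReal (Herman.stepCost (A t ω)) ∂μ ≠ ⊤ := by
    rw [hlint]; exact ENNReal.ofReal_ne_top
  refine ⟨(hA.ae_exists_isStable hA₀).and (hA.ae_cost_eq_totalCost hA₀),
    (integrable_toReal_of_lintegral_ne_top hmeas hfin).congr (hA.ae_totalCost_eq_tsum hA₀), ?_⟩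
  rw [← integral_congr_ae (hA.ae_totalCost_eq_tsum hA₀),
    integral_toReal hmeas (ae_lt_top' hmeas hfin), hlint, ENNReal.toReal_ofReal]
  have := Herman.steg_gaps_nonneg A₀ hA₀
  positivity
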